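/- **Proposition ($p$-Bochner formula).** Let $(M,\langle\cdot,\cdot\rangle)$ be a smooth finite-dimensional Riemannian manifold, possibly with boundary, and let $p>1$. For a function $u$ write $\nabla u$ for its gradient, $H_u$ for its Hessian, $H_u(v,w)=\langle\nabla_v\nabla u,w\rangle$ with $\nabla_v$ the Levi-Civita covariant derivative, $|H_u|$ for the Hilbert–Schmidt norm of $H_u$, $\Delta u=\operatorname{div}\nabla u$, $\Delta_p u=\operatorname{div}(|\nabla u|^{p-2}\nabla u)$ and, where $\nabla u\ne 0$, $$A_u=\frac{H_u(\nabla u,\nabla u)}{|\nabla u|^2},\qquad P^{II}_u(\eta)=|\nabla u|^{p-2}\Delta\eta+(p-2)|\nabla u|^{p-4}H_\eta(\nabla u,\nabla u)$$ (the second-order part of the linearization at $u$ of the $p$-Laplacian). Let $U\subseteq M$ be open and let $u\in C^2(U)$ with $\nabla u\neq 0$ on $U$. Then at every point $x\in U$ at which the second derivatives of $u$ (in local coordinates) are differentiable, in particular at every point of $U$ if $u\in C^3(U)$, $$\frac1p P^{II}_u(|\nabla u|^p)=|\nabla u|^{2(p-2)}\Big\{|\nabla u|^{2-p}\big[\langle\nabla\Delta_p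 u,\nabla u\rangle-(p-2)A_u\,\Delta_p u\big]+|H_u|^2+p(p-2)A_u^2+\operatorname{Ric}(\nabla u,\nabla u)\Big\}.$$ In particular, this equality holds at $x$ if $u$ is an eigenfunction of the $p$-Laplacian near $x$, that is $u$ is $C^2$ near $x$ with $\Delta_p u=-\lambda|u|^{p-2}u$ there for some $\lambda\in\mathbb R$, if $\nabla u(x)\ne0$, and if the second derivatives of $u$ are differentiable at $x$. -/

import Mathlib

open Set Filter Topology Bundle Manifold
open scoped ContDiff

noncomputable section

namespace PBochner

section Christoffel

variable {E : Type*} [NormedAddCommGroup E] [NormedSpace ℝ E]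

set_option synthInstance.maxHeartbeats 200000 in
/-- For a metric `G` on `s ⊆ E`, the Christoffel symbols of the first kind, as the linear form
`k ↦ (1/2) (∂_v G(w, k) + ∂_w G(v, k) - ∂_k G(v, w))`. -/
def christoffelFirst (G : E → E →L[ℝ] E →L[ℝ] ℝ) (s : Set E) (z v w : E) : E →L[ℝ] ℝ :=
  letI D : E →L[ℝ] E →L[ℝ] E →L[ℝ] ℝ := fderivWithin ℝ G s z
  (1 / 2 : ℝ) • (D v w + D w v - (D.flip v).flip w)

/-- The Christoffel symbols of the Levi-Civita connection of `G`: the vector `Γ(v, w)` with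
`G(Γ(v, w), k) = christoffelFirst v w k` for all `k`. -/
def christoffel (G : E → E →L[ℝ] E →L[ℝ] ℝ) (s : Set E) (z v w : E) : E :=
  (G z).inverse (christoffelFirst G s z v w)

/-- The curvature tensor of `G`: `R(a, v) w = ∇_a ∇_v w - ∇_v ∇_a w` for constant fields
`a, v, w`. -/
def curvature (G : E → E →L[ℝ] E →L[ℝ] ℝ) (s : Set E) (z a v w : E) : E :=
  fderivWithin ℝ (fun z' ↦ christoffel G s z' v w) s z a
    - fderivWithin ℝ (fun z' ↦ christoffel G s z' a w) s z v
    + christoffel G s z a (christoffel G s z v w)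
    - christoffel G s z v (christoffel G s z a w)

end Christoffel

section Chart

variable {E : Type*} [NormedAddCommGroup E] [NormedSpace ℝ E]
  {H : Type*} [TopologicalSpace H] (I : ModelWithCorners ℝ E H)
  {M : Type*} [TopologicalSpace M] [ChartedSpace H M] [IsManifold I ∞ M]
  [RiemannianBundle (fun x : M ↦ TangentSpace I x)]

/-- The Riemannian metric in the (extended) chart at `c`, at the point `z` of the model space:
`(v, w) ↦ ⟨d(φ_c⁻¹)_z v, d(φ_c⁻¹)_z w⟩`. On basis vectors these are the coefficients `g_ij`. -/
def chartMetric (c : M) (z : E) : E →L[ℝ] E →L[ℝ] ℝ :=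
  letI T : E →L[ℝ] TangentSpace I ((extChartAt I c).symm z) :=
    mfderivWithin 𝓘(ℝ, E) I (extChartAt I c).symm (range I) z
  (innerSL ℝ (E := TangentSpace I ((extChartAt I c).symm z))).bilinearComp T T

/-- The Levi-Civita covariant derivative `∇_v X` at `x`, computed in the chart at `x`. (The tangent
space at `x` is identified with `E` through the derivative of this chart, by definition.) -/
def covDeriv (X : ∀ y : M, TangentSpace I y) (x : M) (v : TangentSpace I x) : TangentSpace I x :=
  letI Y : E → E := VectorField.mpullbackWithin 𝓘(ℝ, E) I (extChartAt I x).symm X (range I)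
  letI z : E := extChartAt I x x
  letI r : E := fderivWithin ℝ Y (range I) z v + christoffel (chartMetric I x) (range I) z v (Y z)
  r

/-- The second derivatives of `u` (in the chart at `x`) are differentiable at `x`. -/
def ThriceDifferentiableAt (u : M → ℝ) (x : M) : Prop :=
  DifferentiableWithinAt ℝ
    (fderivWithin ℝ (fderivWithin ℝ (u ∘ (extChartAt I x).symm) (range I)) (range I))
    (range I) (extChartAt I x x)

end Chart

instance {E : Type*} [NormedAddCommGroup E] [NormedSpace ℝ E] [FiniteDimensional ℝ E]
    {H : Type*} [TopologicalSpace H] (I : ModelWithCorners ℝ E H)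
    {M : Type*} [TopologicalSpace M] [ChartedSpace H M] (x : M) :
    FiniteDimensional ℝ (TangentSpace I x) :=
  inferInstanceAs (FiniteDimensional ℝ E)

section Operators

variable {E : Type*} [NormedAddCommGroup E] [NormedSpace ℝ E] [FiniteDimensional ℝ E]
  {H : Type*} [TopologicalSpace H] (I : ModelWithCorners ℝ E H)
  {M : Type*} [TopologicalSpace M] [ChartedSpace H M] [IsManifold I ∞ M]
  [RiemannianBundle (fun x : M ↦ TangentSpace I x)]

/-- The Riemannian gradient: `⟨∇u, w⟩ = du(w)`. -/
def grad (u : M → ℝ) (x : M) : TangentSpace I x :=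
  haveI : CompleteSpace (TangentSpace I x) := FiniteDimensional.complete ℝ _
  letI du : TangentSpace I x →L[ℝ] ℝ := mfderiv I 𝓘(ℝ, ℝ) u x
  (InnerProductSpace.toDual ℝ (TangentSpace I x)).symm du

/-- The divergence of a vector field: the trace of `v ↦ ∇_v X`. -/
def divergence (X : ∀ y : M, TangentSpace I y) (x : M) : ℝ :=
  ∑ i, inner ℝ (covDeriv I X x (stdOrthonormalBasis ℝ (TangentSpace I x) i))
    (stdOrthonormalBasis ℝ (TangentSpace I x) i)

/-- The Hessian `H_u(v, w) = ⟨∇_v ∇u, w⟩`. -/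
def hessian (u : M → ℝ) (x : M) (v w : TangentSpace I x) : ℝ :=
  inner ℝ (covDeriv I (grad I u) x v) w

/-- The squared Hilbert-Schmidt norm `|H_u|²` of the Hessian. -/
def hessianNormSq (u : M → ℝ) (x : M) : ℝ :=
  ∑ i, ∑ j, (hessian I u x (stdOrthonormalBasis ℝ (TangentSpace I x) i)
    (stdOrthonormalBasis ℝ (TangentSpace I x) j)) ^ 2

/-- The Laplace-Beltrami operator `Δu = div ∇u`. -/
def laplacian (u : M → ℝ) (x : M) : ℝ := divergence I (grad I u) x

/-- The `p`-Laplacian `Δ_p u = div (|∇u|^(p-2) ∇u)`. -/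
def pLaplacian (p : ℝ) (u : M → ℝ) (x : M) : ℝ :=
  divergence I (fun y ↦ (‖grad I u y‖ ^ (p - 2)) • grad I u y) x

/-- `A_u = H_u(∇u, ∇u) / |∇u|²`. -/
def hessA (u : M → ℝ) (x : M) : ℝ :=
  hessian I u x (grad I u x) (grad I u x) / ‖grad I u x‖ ^ 2

/-- The Ricci curvature `Ric(v, w)`: the trace of `a ↦ R(a, v) w`. -/
def ricci (x : M) (v w : TangentSpace I x) : ℝ :=
  letI R : TangentSpace I x → TangentSpace I x :=
    fun a ↦ curvature (E := E) (chartMetric I x) (range I) (extChartAt I x x) a v w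
  ∑ i, inner ℝ (R (stdOrthonormalBasis ℝ (TangentSpace I x) i))
    (stdOrthonormalBasis ℝ (TangentSpace I x) i)

/-- The second order part of the linearization at `u` of the `p`-Laplacian,
`P^II_u(η) = |∇u|^(p-2) Δη + (p-2) |∇u|^(p-4) H_η(∇u, ∇u)`. -/
def linPLaplacianII (p : ℝ) (u η : M → ℝ) (x : M) : ℝ :=
  ‖grad I u x‖ ^ (p - 2) * laplacian I η x
    + (p - 2) * ‖grad I u x‖ ^ (p - 4) * hessian I η x (grad I u x) (grad I u x)

/-- The `p`-Bochner identity for `u` at the point `x`. -/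
def PBochnerIdentityAt (p : ℝ) (u : M → ℝ) (x : M) : Prop :=
  1 / p * linPLaplacianII I p u (fun y ↦ ‖grad I u y‖ ^ p) x =
    ‖grad I u x‖ ^ (2 * (p - 2)) *
      (‖grad I u x‖ ^ (2 - p) *
          (inner ℝ (grad I (pLaplacian I p u) x) (grad I u x)
            - (p - 2) * hessA I u x * pLaplacian I p u x)
        + hessianNormSq I u x + p * (p - 2) * hessA I u x ^ 2
        + ricci I x (grad I u x) (grad I u x))

end Operators

end PBochner

end

noncomputable section

namespace PBochner

set_option maxSynthPendingDepth 3

section Local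

variable {E : Type*} [NormedAddCommGroup E] [NormedSpace ℝ E]

/-- Symmetry of the second derivative at a point of a convex set, for a function that is
differentiable within the set only near the point. -/
theorem second_derivative_symmetric_of_eventually {F : Type*} [NormedAddCommGroup F]
    [NormedSpace ℝ F] {s : Set E} (hs : Convex ℝ s)
    (hne : (interior s).Nonempty) {f : E → F} {f' : E → E →L[ℝ] F} {f'' : E →L[ℝ] E →L[ℝ] F}
    {x : E} (hx : x ∈ s) (hf : ∀ᶠ z in 𝓝[s] x, HasFDerivWithinAt f (f' z) s z)
    (hf' : HasFDerivWithinAt f' f'' s x) (v w : E) : f'' v w = f'' w v := by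
  obtain ⟨ε, hε, hball⟩ := Metric.mem_nhdsWithin_iff.1 hf
  have hxc : x ∈ closure (interior s) := by
    rw [hs.closure_interior_eq_closure_of_nonempty_interior hne]; exact subset_closure hx
  have hint : interior (Metric.ball x ε ∩ s) = Metric.ball x ε ∩ interior s := by
    rw [interior_inter, Metric.isOpen_ball.interior_eq]
  refine Convex.second_derivative_within_at_symmetric (s := Metric.ball x ε ∩ s)
    ((convex_ball x ε).inter hs) ?_ (f := f) (f' := f') ?_ ⟨Metric.mem_ball_self hε, hx⟩ ?_ v w
  · rw [hint]
    exact mem_closure_iff.1 hxc _ Metric.isOpen_ball (Metric.mem_ball_self hε)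
  · intro z hz
    rw [hint] at hz
    exact (hball ⟨hz.1, interior_subset hz.2⟩).hasFDerivAt (mem_interior_iff_mem_nhds.1 hz.2)
  · exact hf'.mono (interior_subset.trans inter_subset_right)

/-- The covariant derivative `v ↦ ∇_v X` of a vector field, for the connection with
Christoffel symbols `Γ`. -/
def localCovDeriv (Γ : E → E →L[ℝ] E →L[ℝ] E) (s : Set E) (X : E → E) (z : E) : E →L[ℝ] E :=
  fderivWithin ℝ X s z + (Γ z).flip (X z)

/-- The curvature tensor of the connection with Christoffel symbols `Γ` and derivative `Γ'`
of `Γ` at the point under consideration, as the endomorphism `a ↦ R(a, v) w`. -/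
def localCurvature (Γ : E →L[ℝ] E →L[ℝ] E) (Γ' : E →L[ℝ] E →L[ℝ] E →L[ℝ] E) (v w : E) :
    E →L[ℝ] E :=
  (Γ'.flip v).flip w - (Γ' v).flip w + Γ.flip (Γ v w) - Γ v ∘L Γ.flip w

theorem localCurvature_apply (Γ : E →L[ℝ] E →L[ℝ] E) (Γ' : E →L[ℝ] E →L[ℝ] E →L[ℝ] E)
    (a v w : E) :
    localCurvature Γ Γ' v w a = Γ' a v w - Γ' v a w + Γ a (Γ v w) - Γ v (Γ a w) := by
  simp [localCurvature]

/-- The trace as a continuous linear form on the endomorphisms. -/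
def traceL (E : Type*) [NormedAddCommGroup E] [NormedSpace ℝ E] [FiniteDimensional ℝ E] :
    (E →L[ℝ] E) →L[ℝ] ℝ :=
  LinearMap.toContinuousLinearMap (LinearMap.trace ℝ E ∘ₗ ContinuousLinearMap.coeLM ℝ)

theorem traceL_apply [FiniteDimensional ℝ E] (A : E →L[ℝ] E) :
    traceL E A = LinearMap.trace ℝ E (A : E →ₗ[ℝ] E) := rfl

theorem traceL_comp_comm [FiniteDimensional ℝ E] (A B : E →L[ℝ] E) :
    traceL E (A ∘L B) = traceL E (B ∘L A) := by
  simp only [traceL_apply]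
  exact LinearMap.trace_comp_comm' _ _

theorem traceL_smulRight [FiniteDimensional ℝ E] (l : E →L[ℝ] ℝ) (x : E) :
    traceL E (l.smulRight x) = l x := by
  rw [traceL_apply]
  exact LinearMap.trace_smulRight (l : E →ₗ[ℝ] ℝ) x

/-- The derivative of `⟨X, Y⟩` in terms of the covariant derivatives. -/
theorem hasFDerivWithinAt_metric_apply {G : E → E →L[ℝ] E →L[ℝ] ℝ}
    {G' : E →L[ℝ] E →L[ℝ] E →L[ℝ] ℝ}
    {Γ : E →L[ℝ] E →L[ℝ] E} {X Y : E → E} {X' Y' : E →L[ℝ] E} {s : Set E} {z : E}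
    (hG : HasFDerivWithinAt G G' s z)
    (hc : ∀ v w k, G' v w k = G z (Γ v w) k + G z w (Γ v k))
    (hX : HasFDerivWithinAt X X' s z) (hY : HasFDerivWithinAt Y Y' s z) :
    HasFDerivWithinAt (fun y ↦ G y (X y) (Y y))
      ((G z).flip (Y z) ∘L (X' + Γ.flip (X z)) + G z (X z) ∘L (Y' + Γ.flip (Y z))) s z := by
  refine ((hG.clm_apply hX).clm_apply hY).congr_fderiv ?_
  ext v
  simp [hc]
  ring

/-- The local form of the `p`-Bochner formula: `g` is the gradient field, `B = ∇g` the Hessian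
endomorphism, and `z ↦ p |g|^(p-2) B g` the gradient of `|g|^p`. -/
theorem local_pBochner [FiniteDimensional ℝ E] {s : Set E} (hs : Convex ℝ s)
    (hne : (interior s).Nonempty) (hu : UniqueDiffOn ℝ s)
    {z : E} (hz : z ∈ s) {G : E → E →L[ℝ] E →L[ℝ] ℝ} {G' : E →L[ℝ] E →L[ℝ] E →L[ℝ] ℝ}
    {Γ : E → E →L[ℝ] E →L[ℝ] E} {Γ' : E →L[ℝ] E →L[ℝ] E →L[ℝ] E}
    {g : E → E} {g' : E → E →L[ℝ] E} {g'' : E →L[ℝ] E →L[ℝ] E} {p : ℝ} (hp : p ≠ 0)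
    (hG : HasFDerivWithinAt G G' s z) (hsymm : ∀ v w, G z v w = G z w v)
    (hc : ∀ v w k, G' v w k = G z (Γ z v w) k + G z w (Γ z v k))
    (hΓ : HasFDerivWithinAt Γ Γ' s z) (hΓsymm : ∀ v w, Γ z v w = Γ z w v)
    (hg : ∀ᶠ y in 𝓝[s] z, HasFDerivWithinAt g (g' y) s y)
    (hg' : HasFDerivWithinAt g' g'' s z)
    {B : E → E →L[ℝ] E} (hB : ∀ y, B y = g' y + (Γ y).flip (g y))
    (hBsymm : ∀ v w, G z (B z v) w = G z (B z w) v)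
    {f : E → ℝ} (hf : ∀ y, f y = G y (g y) (g y)) (hpos : 0 < f z)
    {X : E → E} (hX : ∀ y, X y = (p * f y ^ ((p - 2) / 2)) • B y (g y))
    {L : E → ℝ}
    (hL : ∀ y, L y = f y ^ ((p - 2) / 2) *
      (traceL E (B y) + (p - 2) * (G y (B y (g y)) (g y) / f y))) :
    DifferentiableWithinAt ℝ L s z ∧
    1 / p * (f z ^ ((p - 2) / 2) * traceL E (localCovDeriv Γ s X z)
      + (p - 2) * f z ^ ((p - 4) / 2) * G z (localCovDeriv Γ s X z (g z)) (g z)) =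
    f z ^ (p - 2) * (f z ^ ((2 - p) / 2) * (fderivWithin ℝ L s z (g z)
        - (p - 2) * (G z (B z (g z)) (g z) / f z) * L z)
      + traceL E (B z ∘L B z) + p * (p - 2) * (G z (B z (g z)) (g z) / f z) ^ 2
      + traceL E (localCurvature (Γ z) Γ' (g z) (g z))) := by
  have hgz : HasFDerivWithinAt g (g' z) s z := hg.self_of_nhdsWithin hz
  have huz := hu z hz
  have hsnd := second_derivative_symmetric_of_eventually hs hne hz hg hg'
  -- the derivative of `B`
  obtain ⟨B', hB', hB'apply⟩ : ∃ B' : E →L[ℝ] E →L[ℝ] E, HasFDerivWithinAt B B' s z ∧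
      ∀ v w, B' v w = g'' v w + Γ' v w (g z) + Γ z w (g' z v) := by
    have hfl : HasFDerivWithinAt (fun y ↦ (Γ y).flip)
        ((ContinuousLinearMap.flipₗᵢ ℝ E E E).toContinuousLinearEquiv.toContinuousLinearMap ∘L Γ')
        s z :=
      ((ContinuousLinearMap.flipₗᵢ ℝ E E E).toContinuousLinearEquiv.toContinuousLinearMap
        |>.hasFDerivAt.comp_hasFDerivWithinAt z hΓ)
    refine ⟨_, (hg'.add (hfl.clm_apply hgz)).congr (fun y _ ↦ hB y) (hB z), ?_⟩
    intro v w
    simp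
    abel
  -- the covariant derivative of `B`
  set N : E →L[ℝ] E →L[ℝ] E := B' + (ContinuousLinearMap.compL ℝ E E E).flip (B z) ∘L Γ z
    - (ContinuousLinearMap.compL ℝ E E E (B z)) ∘L Γ z with hN
  have hNapply : ∀ v w, N v w = B' v w + Γ z v (B z w) - B z (Γ z v w) := by
    intro v w; simp [hN]
  have hcod : N.flip (g z) = N (g z) + localCurvature (Γ z) Γ' (g z) (g z) := by
    ext v
    simp only [ContinuousLinearMap.flip_apply, add_apply, hNapply,
      hB'apply, localCurvature_apply, hB, map_add]
    rw [hsnd v (g z), hΓsymm v (g z)]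
    abel
  have htrN : traceL E (N (g z)) = traceL E (B' (g z)) := by
    have : N (g z) = B' (g z) + (Γ z (g z) ∘L B z - B z ∘L Γ z (g z)) := by
      ext v; simp [hNapply]; abel
    rw [this, map_add, map_sub, traceL_comp_comm (B z), sub_self, add_zero]
  have hBg : HasFDerivWithinAt (fun y ↦ B y (g y)) (B z ∘L g' z + B'.flip (g z)) s z :=
    hB'.clm_apply hgz
  have hcovBg : B z ∘L g' z + B'.flip (g z) + (Γ z).flip (B z (g z))
      = N.flip (g z) + B z ∘L B z := by
    ext v
    have : B z v = g' z v + Γ z v (g z) := by simp [hB]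
    simp [hNapply, this]
    abel
  have hf' : HasFDerivWithinAt f ((2 : ℝ) • G z (B z (g z))) s z := by
    refine ((hasFDerivWithinAt_metric_apply hG hc hgz hgz).congr (fun y _ ↦ hf y) (hf z)).congr_fderiv
      ?_
    ext v
    rw [← hB]
    simp [hsymm (g z), hBsymm v]
    ring
  have hfq : HasFDerivWithinAt (fun y ↦ f y ^ ((p - 2) / 2))
      (((p - 2) * f z ^ ((p - 2) / 2) / f z) • G z (B z (g z))) s z := by
    refine (hf'.rpow_const (Or.inl hpos.ne')).congr_fderiv ?_
    rw [smul_smul, Real.rpow_sub_one hpos.ne']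
    congr 1
    ring
  have hh : HasFDerivWithinAt (fun y ↦ G y (B y (g y)) (g y))
      ((G z).flip (g z) ∘L (N.flip (g z) + B z ∘L B z) + G z (B z (g z)) ∘L B z) s z := by
    have := hasFDerivWithinAt_metric_apply hG hc hBg hgz
    rwa [hcovBg, ← hB] at this
  have hX' : HasFDerivWithinAt X ((p * f z ^ ((p - 2) / 2)) • (B z ∘L g' z + B'.flip (g z)) +
      (p • (((p - 2) * f z ^ ((p - 2) / 2) / f z) • G z (B z (g z)))).smulRight (B z (g z))) s z :=
    ((hfq.const_mul p).smul hBg).congr (fun y _ ↦ hX y) (hX z)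
  have hA : HasFDerivWithinAt (fun y ↦ G y (B y (g y)) (g y) / f y)
      ((G z (B z (g z)) (g z)) • ((-(f z ^ 2)⁻¹) • ((2 : ℝ) • G z (B z (g z)))) + (f z)⁻¹ •
        ((G z).flip (g z) ∘L (N.flip (g z) + B z ∘L B z) + G z (B z (g z)) ∘L B z)) s z := by
    simp only [div_eq_mul_inv]
    exact hh.mul ((hasDerivAt_inv hpos.ne').comp_hasFDerivWithinAt z hf')
  have hL' := ((hfq.mul (((traceL E).hasFDerivAt.comp_hasFDerivWithinAt z hB').add
    (hA.const_mul (p - 2)))).congr (fun y _ ↦ hL y) (hL z))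
  refine ⟨hL'.differentiableWithinAt, ?_⟩
  have hcov : localCovDeriv Γ s X z = (p * f z ^ ((p - 2) / 2)) •
      (N.flip (g z) + B z ∘L B z +
        ((((p - 2) / f z) • G z (B z (g z)))).smulRight (B z (g z))) := by
    rw [localCovDeriv, hX'.fderivWithin huz, ← hcovBg, hX z]
    ext v
    simp
    module
  have hA' : G z (B z (B z (g z))) (g z) = G z (B z (g z)) (B z (g z)) := hBsymm _ _
  have htr : traceL E (N.flip (g z)) =
      traceL E (B' (g z)) + traceL E (localCurvature (Γ z) Γ' (g z) (g z)) := by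
    rw [hcod, map_add, htrN]
  have e1 : f z ^ ((p - 4) / 2) = f z ^ ((p - 2) / 2) / f z := by
    rw [← Real.rpow_sub_one hpos.ne']; congr 1; ring
  have e2 : f z ^ ((2 - p) / 2) = (f z ^ ((p - 2) / 2))⁻¹ := by
    rw [← Real.rpow_neg hpos.le]; congr 1; ring
  have e3 : f z ^ (p - 2) = f z ^ ((p - 2) / 2) * f z ^ ((p - 2) / 2) := by
    rw [← Real.rpow_add hpos]; congr 1; ring
  have hq : 0 < f z ^ ((p - 2) / 2) := Real.rpow_pos_of_pos hpos _
  rw [hcov, hL'.fderivWithin huz, hL z, e1, e2, e3]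
  simp only [map_add, map_smul, traceL_smulRight, htr, add_apply, smul_apply, smul_eq_mul,
    ContinuousLinearMap.comp_apply, ContinuousLinearMap.flip_apply,
    ContinuousLinearMap.smulRight_apply, hA', Pi.add_apply, Function.comp_apply]
  generalize f z ^ ((p - 2) / 2) = q at *
  have := hpos.ne'
  have := hq.ne'
  field_simp
  ring

end Local

section ChristoffelSymbols

variable {E : Type*} [NormedAddCommGroup E] [NormedSpace ℝ E]

/-- The Christoffel symbols of the first kind as a function of the derivative of the metric,
bundled as a trilinear form. -/
def christoffelFirstL (D : E →L[ℝ] E →L[ℝ] E →L[ℝ] ℝ) : E →L[ℝ] E →L[ℝ] E →L[ℝ] ℝ :=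
  (1 / 2 : ℝ) • (D + D.flip -
    (ContinuousLinearMap.flipₗᵢ ℝ E E ℝ).toContinuousLinearEquiv.toContinuousLinearMap ∘L D.flip)

theorem christoffelFirstL_apply (D : E →L[ℝ] E →L[ℝ] E →L[ℝ] ℝ) (v w k : E) :
    christoffelFirstL D v w k = 1 / 2 * (D v w k + D w v k - D k v w) := by
  simp [christoffelFirstL]

/-- The Christoffel symbols, bundled as a bilinear map. -/
def christoffelL (G : E → E →L[ℝ] E →L[ℝ] ℝ) (s : Set E) (z : E) : E →L[ℝ] E →L[ℝ] E :=
  (ContinuousLinearMap.compL ℝ E (E →L[ℝ] ℝ) E (G z).inverse) ∘L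
    christoffelFirstL (fderivWithin ℝ G s z)

theorem christoffelL_apply (G : E → E →L[ℝ] E →L[ℝ] ℝ) (s : Set E) (z v w : E) :
    christoffelL G s z v w = christoffel G s z v w := by
  simp [christoffelL, christoffel, christoffelFirst, christoffelFirstL]

variable {G : E → E →L[ℝ] E →L[ℝ] ℝ} {s : Set E} {z : E}

theorem metric_christoffelL (hi : (G z).IsInvertible) (v w k : E) :
    G z (christoffelL G s z v w) k = 1 / 2 * (fderivWithin ℝ G s z v w k +
      fderivWithin ℝ G s z w v k - fderivWithin ℝ G s z k v w) := by
  obtain ⟨e, he⟩ := hi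
  rw [← christoffelFirstL_apply]
  simp [christoffelL, ← he]

/-- The derivative of a family of symmetric forms is symmetric. -/
theorem fderivWithin_symmetric (hu : UniqueDiffWithinAt ℝ s z)
    (hG : DifferentiableWithinAt ℝ G s z) (hz : z ∈ s)
    (hsymm : ∀ᶠ y in 𝓝[s] z, ∀ v w, G y v w = G y w v) (k v w : E) :
    fderivWithin ℝ G s z k v w = fderivWithin ℝ G s z k w v := by
  have h1 := (ContinuousLinearMap.flipₗᵢ ℝ E E ℝ).toContinuousLinearEquiv.toContinuousLinearMap
    |>.hasFDerivAt.comp_hasFDerivWithinAt z hG.hasFDerivWithinAt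
  have h2 : HasFDerivWithinAt G _ s z := h1.congr_of_eventuallyEq
    (hsymm.mono fun y hy ↦ by ext v w; simp [hy v w])
    (by ext v w; simp [hsymm.self_of_nhdsWithin hz v w])
  have h3 := hu.eq h2 hG.hasFDerivWithinAt
  conv_lhs => rw [← h3]
  simp

theorem christoffelL_symm (hu : UniqueDiffWithinAt ℝ s z)
    (hG : DifferentiableWithinAt ℝ G s z) (hz : z ∈ s)
    (hsymm : ∀ᶠ y in 𝓝[s] z, ∀ v w, G y v w = G y w v) (v w : E) :
    christoffelL G s z v w = christoffelL G s z w v := by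
  have : christoffelFirstL (fderivWithin ℝ G s z) v w =
      christoffelFirstL (fderivWithin ℝ G s z) w v := by
    ext k
    rw [christoffelFirstL_apply, christoffelFirstL_apply,
      fderivWithin_symmetric hu hG hz hsymm k v w]
    ring
  simp [christoffelL, this]

/-- The Levi-Civita connection is compatible with the metric. -/
theorem fderivWithin_metric (hu : UniqueDiffWithinAt ℝ s z)
    (hG : DifferentiableWithinAt ℝ G s z) (hz : z ∈ s) (hi : (G z).IsInvertible)
    (hsymm : ∀ᶠ y in 𝓝[s] z, ∀ v w, G y v w = G y w v) (v w k : E) :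
    fderivWithin ℝ G s z v w k =
      G z (christoffelL G s z v w) k + G z w (christoffelL G s z v k) := by
  rw [hsymm.self_of_nhdsWithin hz w, metric_christoffelL hi, metric_christoffelL hi,
    fderivWithin_symmetric hu hG hz hsymm v k w]
  ring

/-- The Levi-Civita connection is the only torsion-free connection that is compatible with the
metric. -/
theorem eq_christoffelL (hi : (G z).IsInvertible) (hsymm : ∀ v w, G z v w = G z w v)
    {Γ : E → E → E} (hΓ : ∀ v w, Γ v w = Γ w v)
    (hc : ∀ v w k, fderivWithin ℝ G s z v w k = G z (Γ v w) k + G z w (Γ v k)) (v w : E) :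
    Γ v w = christoffelL G s z v w := by
  apply hi.injective
  ext k
  rw [metric_christoffelL hi, hc, hc, hc, hΓ w v, hΓ w k, hΓ k v, hsymm w, hsymm (Γ v k) w,
    hΓ k w, hsymm v]
  ring

theorem differentiableWithinAt_christoffelL [FiniteDimensional ℝ E] (hu : UniqueDiffOn ℝ s)
    (hz : z ∈ s) (hG : ContDiffWithinAt ℝ 2 G s z) (hi : (G z).IsInvertible) :
    DifferentiableWithinAt ℝ (christoffelL G s) s z := by
  have : CompleteSpace E := FiniteDimensional.complete ℝ E
  have h1 : DifferentiableWithinAt ℝ (fderivWithin ℝ G s) s z :=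
    (hG.fderivWithin_right (m := 1) hu le_rfl hz).differentiableWithinAt one_ne_zero
  have h2 : DifferentiableWithinAt ℝ (fun y ↦ (G y).inverse) s z :=
    (hi.contDiffAt_map_inverse (n := 1)).differentiableAt one_ne_zero
      |>.comp_differentiableWithinAt z (hG.differentiableWithinAt two_ne_zero)
  have h3 : DifferentiableWithinAt ℝ (fun y ↦ (fderivWithin ℝ G s y).flip) s z :=
    (ContinuousLinearMap.flipₗᵢ ℝ E E (E →L[ℝ] ℝ)).toContinuousLinearEquiv.toContinuousLinearMap
      |>.differentiableAt.comp_differentiableWithinAt z h1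
  unfold christoffelL christoffelFirstL
  exact ((ContinuousLinearMap.compL ℝ E (E →L[ℝ] ℝ) E).differentiableAt.comp_differentiableWithinAt
    z h2).clm_comp (((h1.fun_add h3).fun_sub
      ((differentiableWithinAt_const _).clm_comp h3)).fun_const_smul _)

/-- The covariant derivative commutes with changes of coordinates. -/
theorem localCovDeriv_comp [FiniteDimensional ℝ E] (hs : Convex ℝ s)
    (hne : (interior s).Nonempty) (hu : UniqueDiffOn ℝ s) (hz : z ∈ s)
    {ψ : E → E} (hψ : ContDiffWithinAt ℝ 2 ψ s z) (hmaps : ∀ᶠ y in 𝓝[s] z, ψ y ∈ s)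
    (hinv : ∀ᶠ y in 𝓝[s] z, (fderivWithin ℝ ψ s y).IsInvertible)
    {G₂ : E → E →L[ℝ] E →L[ℝ] ℝ} (hG : DifferentiableWithinAt ℝ G s (ψ z))
    (hi : (G (ψ z)).IsInvertible) (hi₂ : (G₂ z).IsInvertible)
    (hsymm : ∀ᶠ y in 𝓝[s] (ψ z), ∀ v w, G y v w = G y w v)
    (hG₂ : ∀ᶠ y in 𝓝[s] z, ∀ v w,
      G₂ y v w = G (ψ y) (fderivWithin ℝ ψ s y v) (fderivWithin ℝ ψ s y w))
    {Y Y₂ : E → E} (hY : DifferentiableWithinAt ℝ Y s (ψ z))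
    (hY₂ : ∀ᶠ y in 𝓝[s] z, fderivWithin ℝ ψ s y (Y₂ y) = Y (ψ y)) (v : E) :
    fderivWithin ℝ ψ s z (localCovDeriv (christoffelL G₂ s) s Y₂ z v) =
      localCovDeriv (christoffelL G s) s Y (ψ z) (fderivWithin ℝ ψ s z v) := by
  have : CompleteSpace E := FiniteDimensional.complete ℝ E
  have hψz : ψ z ∈ s := hmaps.self_of_nhdsWithin hz
  set A : E → E →L[ℝ] E := fderivWithin ℝ ψ s with hAdef
  have hAd : HasFDerivWithinAt A (fderivWithin ℝ A s z) s z :=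
    ((hψ.fderivWithin_right (m := 1) hu le_rfl hz).differentiableWithinAt
      one_ne_zero).hasFDerivWithinAt
  set A' := fderivWithin ℝ A s z
  have hψd : ∀ᶠ y in 𝓝[s] z, HasFDerivWithinAt ψ (A y) s y := by
    have := hψ.eventually (by simp)
    rw [insert_eq_of_mem hz] at this
    exact this.mono fun y hy ↦ (hy.differentiableWithinAt two_ne_zero).hasFDerivWithinAt
  have hA'symm : ∀ v w, A' v w = A' w v :=
    second_derivative_symmetric_of_eventually hs hne hz hψd hAd
  have hψdz : HasFDerivWithinAt ψ (A z) s z := hψd.self_of_nhdsWithin hz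
  have htend : Tendsto ψ (𝓝[s] z) (𝓝[s] (ψ z)) :=
    tendsto_nhdsWithin_iff.2 ⟨hψ.continuousWithinAt, hmaps⟩
  have hGψ := hG.hasFDerivWithinAt.comp_of_tendsto z hψdz htend
  have hYψ := hY.hasFDerivWithinAt.comp_of_tendsto z hψdz htend
  have hAz : (A z).IsInvertible := hinv.self_of_nhdsWithin hz
  have hG₂z := hG₂.self_of_nhdsWithin hz
  have hY₂z := hY₂.self_of_nhdsWithin hz
  have hsymmz := hsymm.self_of_nhdsWithin hψz
  -- the derivative of the pulled back metric
  have hG₂' : ∀ v w k, fderivWithin ℝ G₂ s z v w k =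
      fderivWithin ℝ G s (ψ z) (A z v) (A z w) (A z k)
      + G (ψ z) (A' v w) (A z k) + G (ψ z) (A z w) (A' v k) := by
    have h1 : HasFDerivWithinAt (fun y ↦ (ContinuousLinearMap.compL ℝ E E ℝ).flip (A y)) _ s z :=
      ((ContinuousLinearMap.compL ℝ E E ℝ).flip).hasFDerivAt.comp_hasFDerivWithinAt z hAd
    have h2 : HasFDerivWithinAt G₂ _ s z := (h1.clm_comp (hGψ.clm_comp hAd)).congr_of_eventuallyEq
      (hG₂.mono fun y hy ↦ by ext v w; simp [hy v w]) (by ext v w; simp [hG₂z v w])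
    intro v w k
    rw [h2.fderivWithin (hu z hz)]
    simp
    ring
  -- the transformation law of the Christoffel symbols
  have hΓ : ∀ v w, A z (christoffelL G₂ s z v w) =
      A' v w + christoffelL G s (ψ z) (A z v) (A z w) := by
    obtain ⟨e, he⟩ := hAz
    have heA : ∀ v, A z (e.symm v) = v := fun v ↦ by simp [← he]
    intro v w
    rw [← eq_christoffelL hi₂ (fun v w ↦ by rw [hG₂z, hG₂z, hsymmz])
      (Γ := fun v w ↦ e.symm (A' v w + christoffelL G s (ψ z) (A z v) (A z w))) _ _ v w, heA]
    · intro v w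
      rw [hA'symm, christoffelL_symm (hu _ hψz) hG hψz hsymm]
    · intro v w k
      rw [hG₂', hG₂z, hG₂z, heA, heA, fderivWithin_metric (hu _ hψz) hG hψz hi hsymm]
      simp only [map_add, add_apply]
      ring
  have hY₂d : DifferentiableWithinAt ℝ Y₂ s z := by
    have h1 : DifferentiableWithinAt ℝ (fun y ↦ (A y).inverse) s z :=
      (hAz.contDiffAt_map_inverse (n := 1)).differentiableAt one_ne_zero
        |>.comp_differentiableWithinAt z hAd.differentiableWithinAt
    have h2 : ∀ᶠ y in 𝓝[s] z, Y₂ y = (A y).inverse ((Y ∘ ψ) y) := by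
      filter_upwards [hY₂, hinv] with y hy hAy
      rw [Function.comp_apply, ← hy, hAy.inverse_apply_self]
    exact (h1.clm_apply hYψ.differentiableWithinAt).congr_of_eventuallyEq h2
      (h2.self_of_nhdsWithin hz)
  have hY₂' := (hAd.clm_apply hY₂d.hasFDerivWithinAt).congr_of_eventuallyEq
    (f₁ := Y ∘ ψ) (hY₂.mono fun y hy ↦ hy.symm) hY₂z.symm
  have h3 := DFunLike.congr_fun ((hu z hz).eq hY₂' hYψ) v
  simp only [add_apply, ContinuousLinearMap.comp_apply, ContinuousLinearMap.flip_apply] at h3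
  simp only [localCovDeriv, add_apply, ContinuousLinearMap.flip_apply, map_add, hΓ, ← h3, hY₂z]
  abel

end ChristoffelSymbols

section LocalGradient

variable {E : Type*} [NormedAddCommGroup E] [NormedSpace ℝ E]

/-- `G` is a family of nondegenerate symmetric forms on `s` near `z`, twice continuously
differentiable at `z`. -/
structure IsMetricAt (G : E → E →L[ℝ] E →L[ℝ] ℝ) (s : Set E) (z : E) : Prop where
  mem : z ∈ s
  contDiff : ContDiffWithinAt ℝ 2 G s z
  symm : ∀ᶠ y in 𝓝[s] z, ∀ v w, G y v w = G y w v
  inv : ∀ᶠ y in 𝓝[s] z, (G y).IsInvertible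

/-- The gradient of `u` with respect to the metric `G`. -/
def localGrad (G : E → E →L[ℝ] E →L[ℝ] ℝ) (s : Set E) (u : E → ℝ) (z : E) : E :=
  (G z).inverse (fderivWithin ℝ u s z)

variable {G : E → E →L[ℝ] E →L[ℝ] ℝ} {s : Set E} {z : E} {u : E → ℝ}

theorem _root_.ContDiffWithinAt.eventually_nhdsWithin {F : Type*} [NormedAddCommGroup F]
    [NormedSpace ℝ F] {f : E → F} (hf : ContDiffWithinAt ℝ 2 f s z) (hz : z ∈ s) :
    ∀ᶠ y in 𝓝[s] z, ContDiffWithinAt ℝ 2 f s y := by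
  have := hf.eventually (by simp)
  rwa [insert_eq_of_mem hz] at this

theorem _root_.ContDiffWithinAt.differentiableWithinAt_fderivWithin {F : Type*}
    [NormedAddCommGroup F] [NormedSpace ℝ F] {f : E → F} (hf : ContDiffWithinAt ℝ 2 f s z)
    (hu : UniqueDiffOn ℝ s) (hz : z ∈ s) : DifferentiableWithinAt ℝ (fderivWithin ℝ f s) s z :=
  (hf.fderivWithin_right (m := 1) hu le_rfl hz).differentiableWithinAt one_ne_zero

namespace IsMetricAt

theorem eventually (h : IsMetricAt G s z) : ∀ᶠ y in 𝓝[s] z, IsMetricAt G s y := by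
  filter_upwards [self_mem_nhdsWithin, h.contDiff.eventually_nhdsWithin h.mem,
    eventually_eventually_nhdsWithin.2 h.symm, eventually_eventually_nhdsWithin.2 h.inv]
    with y h1 h2 h3 h4 using ⟨h1, h2, h3, h4⟩

theorem symm_self (h : IsMetricAt G s z) (v w : E) : G z v w = G z w v :=
  h.symm.self_of_nhdsWithin h.mem v w

theorem inv_self (h : IsMetricAt G s z) : (G z).IsInvertible := h.inv.self_of_nhdsWithin h.mem

theorem differentiable (h : IsMetricAt G s z) : DifferentiableWithinAt ℝ G s z :=
  h.contDiff.differentiableWithinAt two_ne_zero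

theorem localGrad_apply (h : IsMetricAt G s z) (w : E) :
    G z (localGrad G s u z) w = fderivWithin ℝ u s z w := by
  rw [localGrad, h.inv_self.self_apply_inverse]

variable [FiniteDimensional ℝ E]

theorem differentiableWithinAt_inverse (h : IsMetricAt G s z) :
    DifferentiableWithinAt ℝ (fun y ↦ (G y).inverse) s z := by
  have : CompleteSpace E := FiniteDimensional.complete ℝ E
  exact (h.inv_self.contDiffAt_map_inverse (n := 1)).differentiableAt one_ne_zero
    |>.comp_differentiableWithinAt z h.differentiable

theorem differentiableWithinAt_localGrad (h : IsMetricAt G s z) (hs : UniqueDiffOn ℝ s)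
    (hu : ContDiffWithinAt ℝ 2 u s z) : DifferentiableWithinAt ℝ (localGrad G s u) s z :=
  h.differentiableWithinAt_inverse.clm_apply (hu.differentiableWithinAt_fderivWithin hs h.mem)

theorem metric_localCovDeriv_localGrad (h : IsMetricAt G s z) (hs : UniqueDiffOn ℝ s)
    (hu : ContDiffWithinAt ℝ 2 u s z) (v w : E) :
    G z (localCovDeriv (christoffelL G s) s (localGrad G s u) z v) w =
      fderivWithin ℝ (fderivWithin ℝ u s) s z v w
        - fderivWithin ℝ u s z (christoffelL G s z v w) := by
  have hg := (h.differentiableWithinAt_localGrad hs hu).hasFDerivWithinAt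
  have h1 := (h.differentiable.hasFDerivWithinAt.clm_apply hg).congr_of_eventuallyEq
    (f₁ := fderivWithin ℝ u s)
    (h.eventually.mono fun y hy ↦ by ext w; rw [hy.localGrad_apply])
    (by ext w; rw [h.localGrad_apply])
  rw [h1.fderivWithin (hs z h.mem), ← h.localGrad_apply]
  simp only [localCovDeriv, map_add, add_apply, ContinuousLinearMap.comp_apply,
    ContinuousLinearMap.flip_apply,
    fderivWithin_metric (hs z h.mem) h.differentiable h.mem h.inv_self h.symm]
  ring

theorem localCovDeriv_localGrad_symm (h : IsMetricAt G s z) (hc : Convex ℝ s)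
    (hne : (interior s).Nonempty) (hs : UniqueDiffOn ℝ s)
    (hu : ContDiffWithinAt ℝ 2 u s z) (v w : E) :
    G z (localCovDeriv (christoffelL G s) s (localGrad G s u) z v) w =
      G z (localCovDeriv (christoffelL G s) s (localGrad G s u) z w) v := by
  rw [h.metric_localCovDeriv_localGrad hs hu, h.metric_localCovDeriv_localGrad hs hu,
    christoffelL_symm (hs z h.mem) h.differentiable h.mem h.symm,
    second_derivative_symmetric_of_eventually hc hne h.mem
      ((hu.eventually_nhdsWithin h.mem).mono fun y hy ↦
        (hy.differentiableWithinAt two_ne_zero).hasFDerivWithinAt)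
      (hu.differentiableWithinAt_fderivWithin hs h.mem).hasFDerivWithinAt v w]

theorem differentiableWithinAt_fderivWithin_localGrad (h : IsMetricAt G s z)
    (hs : UniqueDiffOn ℝ s) (hu : ContDiffWithinAt ℝ 2 u s z)
    (hu3 : DifferentiableWithinAt ℝ (fderivWithin ℝ (fderivWithin ℝ u s) s) s z) :
    DifferentiableWithinAt ℝ (fderivWithin ℝ (localGrad G s u) s) s z := by
  have key : ∀ y, IsMetricAt G s y → ContDiffWithinAt ℝ 2 u s y →
      fderivWithin ℝ (localGrad G s u) s y = (G y).inverse ∘L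
        (fderivWithin ℝ (fderivWithin ℝ u s) s y -
          (fderivWithin ℝ G s y).flip (localGrad G s u y)) := by
    intro y hy huy
    have hg := (hy.differentiableWithinAt_localGrad hs huy).hasFDerivWithinAt
    have h1 := (hy.differentiable.hasFDerivWithinAt.clm_apply hg).congr_of_eventuallyEq
      (f₁ := fderivWithin ℝ u s)
      (hy.eventually.mono fun y hy ↦ by ext w; rw [hy.localGrad_apply])
      (by ext w; rw [hy.localGrad_apply])
    rw [h1.fderivWithin (hs y hy.mem)]
    ext v
    simp [hy.inv_self.inverse_apply_self]
  have hfl : DifferentiableWithinAt ℝ (fun y ↦ (fderivWithin ℝ G s y).flip) s z :=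
    (ContinuousLinearMap.flipₗᵢ ℝ E E (E →L[ℝ] ℝ)).toContinuousLinearEquiv.toContinuousLinearMap
      |>.differentiableAt.comp_differentiableWithinAt z
        (h.contDiff.differentiableWithinAt_fderivWithin hs h.mem)
  refine (h.differentiableWithinAt_inverse.clm_comp
    (hu3.fun_sub (hfl.clm_apply (h.differentiableWithinAt_localGrad hs hu)))).congr_of_eventuallyEq
    ?_ (key z h hu)
  filter_upwards [h.eventually, hu.eventually_nhdsWithin h.mem] with y h1 h2 using key y h1 h2

/-- The derivative of `|∇u|²`. -/
theorem hasFDerivWithinAt_normSq_localGrad (h : IsMetricAt G s z) (hc : Convex ℝ s)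
    (hne : (interior s).Nonempty) (hs : UniqueDiffOn ℝ s) (hu : ContDiffWithinAt ℝ 2 u s z) :
    HasFDerivWithinAt (fun y ↦ G y (localGrad G s u y) (localGrad G s u y))
      ((2 : ℝ) • G z (localCovDeriv (christoffelL G s) s (localGrad G s u) z
        (localGrad G s u z))) s z := by
  have hg := (h.differentiableWithinAt_localGrad hs hu).hasFDerivWithinAt
  refine (hasFDerivWithinAt_metric_apply h.differentiable.hasFDerivWithinAt
    (fderivWithin_metric (hs z h.mem) h.differentiable h.mem h.inv_self h.symm)
    hg hg).congr_fderiv ?_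
  rw [← localCovDeriv]
  ext v
  simp [h.symm_self (localGrad G s u z), h.localCovDeriv_localGrad_symm hc hne hs hu v]
  ring

/-- The derivative of `|∇u|^(2r)`. -/
theorem hasFDerivWithinAt_normSq_localGrad_rpow (h : IsMetricAt G s z) (hc : Convex ℝ s)
    (hne : (interior s).Nonempty) (hs : UniqueDiffOn ℝ s) (hu : ContDiffWithinAt ℝ 2 u s z)
    (hpos : 0 < G z (localGrad G s u z) (localGrad G s u z)) (r : ℝ) :
    HasFDerivWithinAt (fun y ↦ G y (localGrad G s u y) (localGrad G s u y) ^ r)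
      ((2 * r * G z (localGrad G s u z) (localGrad G s u z) ^ (r - 1)) •
        G z (localCovDeriv (christoffelL G s) s (localGrad G s u) z (localGrad G s u z))) s z := by
  refine ((h.hasFDerivWithinAt_normSq_localGrad hc hne hs hu).rpow_const
    (Or.inl hpos.ne')).congr_fderiv ?_
  rw [smul_smul]
  congr 1
  ring

theorem localGrad_normSq_rpow (h : IsMetricAt G s z) (hc : Convex ℝ s)
    (hne : (interior s).Nonempty) (hs : UniqueDiffOn ℝ s) (hu : ContDiffWithinAt ℝ 2 u s z)
    (hpos : 0 < G z (localGrad G s u z) (localGrad G s u z)) (r : ℝ) :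
    localGrad G s (fun y ↦ G y (localGrad G s u y) (localGrad G s u y) ^ r) z =
      (2 * r * G z (localGrad G s u z) (localGrad G s u z) ^ (r - 1)) •
        localCovDeriv (christoffelL G s) s (localGrad G s u) z (localGrad G s u z) := by
  rw [localGrad, (h.hasFDerivWithinAt_normSq_localGrad_rpow hc hne hs hu hpos r).fderivWithin
    (hs z h.mem), map_smul, h.inv_self.inverse_apply_self]

/-- The divergence of `|∇u|^(2r) ∇u`. -/
theorem trace_localCovDeriv_normSq_rpow_smul (h : IsMetricAt G s z) (hc : Convex ℝ s)
    (hne : (interior s).Nonempty) (hs : UniqueDiffOn ℝ s) (hu : ContDiffWithinAt ℝ 2 u s z)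
    (hpos : 0 < G z (localGrad G s u z) (localGrad G s u z)) (r : ℝ) :
    DifferentiableWithinAt ℝ (fun y ↦ G y (localGrad G s u y) (localGrad G s u y) ^ r •
      localGrad G s u y) s z ∧
    traceL E (localCovDeriv (christoffelL G s) s (fun y ↦
      G y (localGrad G s u y) (localGrad G s u y) ^ r • localGrad G s u y) z) =
    G z (localGrad G s u z) (localGrad G s u z) ^ r *
      (traceL E (localCovDeriv (christoffelL G s) s (localGrad G s u) z) +
        2 * r * (G z (localCovDeriv (christoffelL G s) s (localGrad G s u) z
          (localGrad G s u z)) (localGrad G s u z) /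
            G z (localGrad G s u z) (localGrad G s u z))) := by
  have hg := (h.differentiableWithinAt_localGrad hs hu).hasFDerivWithinAt
  have h1 := (h.hasFDerivWithinAt_normSq_localGrad_rpow hc hne hs hu hpos r).fun_smul hg
  refine ⟨h1.differentiableWithinAt, ?_⟩
  have h2 : ∀ (c : ℝ) (A : E →L[ℝ] E) (l : E →L[ℝ] ℝ),
      c • A + l.smulRight (localGrad G s u z) +
        (christoffelL G s z).flip (c • localGrad G s u z) =
      c • (A + (christoffelL G s z).flip (localGrad G s u z)) +
        l.smulRight (localGrad G s u z) := by
    intro c A l; rw [map_smul]; module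
  rw [localCovDeriv, h1.fderivWithin (hs z h.mem), h2, ← localCovDeriv, map_add, map_smul,
    traceL_smulRight, Real.rpow_sub_one hpos.ne']
  simp only [smul_apply, smul_eq_mul]
  ring

end IsMetricAt
end LocalGradient

section LocalBochner

variable {E : Type*} [NormedAddCommGroup E] [NormedSpace ℝ E]
  {G : E → E →L[ℝ] E →L[ℝ] ℝ} {s : Set E} {z : E} {u : E → ℝ}

theorem localCovDeriv_congr {Γ : E → E →L[ℝ] E →L[ℝ] E} {X Y : E → E} (hz : z ∈ s)
    (h : ∀ᶠ y in 𝓝[s] z, X y = Y y) : localCovDeriv Γ s X z = localCovDeriv Γ s Y z := by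
  have hz' := h.self_of_nhdsWithin hz
  rw [localCovDeriv, localCovDeriv, Filter.EventuallyEq.fderivWithin_eq h hz', hz']

/-- The `p`-Bochner formula in a chart. -/
theorem IsMetricAt.pBochner [FiniteDimensional ℝ E] (h : IsMetricAt G s z) (hc : Convex ℝ s)
    (hne : (interior s).Nonempty) (hs : UniqueDiffOn ℝ s) (hu : ContDiffWithinAt ℝ 2 u s z)
    (hu3 : DifferentiableWithinAt ℝ (fderivWithin ℝ (fderivWithin ℝ u s) s) s z)
    {p : ℝ} (hp : p ≠ 0) {g : E → E} (hg : g = localGrad G s u)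
    {f : E → ℝ} (hf : f = fun y ↦ G y (g y) (g y)) (hpos : 0 < f z)
    {Γ : E → E →L[ℝ] E →L[ℝ] E} (hΓ : Γ = christoffelL G s)
    {B : E →L[ℝ] E} (hB : B = localCovDeriv Γ s g z)
    {C : E →L[ℝ] E} (hC : C = localCovDeriv Γ s (localGrad G s fun y ↦ f y ^ (p / 2)) z)
    {L : E → ℝ}
    (hL : L = fun y ↦ traceL E (localCovDeriv Γ s (fun y ↦ f y ^ ((p - 2) / 2) • g y) y)) :
    DifferentiableWithinAt ℝ L s z ∧
    1 / p * (f z ^ ((p - 2) / 2) * traceL E C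
      + (p - 2) * f z ^ ((p - 4) / 2) * G z (C (g z)) (g z)) =
    f z ^ (p - 2) * (f z ^ ((2 - p) / 2) * (fderivWithin ℝ L s z (g z)
        - (p - 2) * (G z (B (g z)) (g z) / f z) * L z)
      + traceL E (B ∘L B) + p * (p - 2) * (G z (B (g z)) (g z) / f z) ^ 2
      + traceL E (localCurvature (Γ z) (fderivWithin ℝ Γ s z) (g z) (g z))) := by
  subst hB hC
  have hfd : ContinuousWithinAt f s z := by
    rw [hf, hg]; exact (h.hasFDerivWithinAt_normSq_localGrad hc hne hs hu).continuousWithinAt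
  have hfpos : ∀ᶠ y in 𝓝[s] z, 0 < f y := hfd.eventually (lt_mem_nhds hpos)
  have hev : ∀ᶠ y in 𝓝[s] z, IsMetricAt G s y ∧ ContDiffWithinAt ℝ 2 u s y ∧ 0 < f y := by
    filter_upwards [h.eventually, hu.eventually_nhdsWithin h.mem, hfpos] with y h1 h2 h3
      using ⟨h1, h2, h3⟩
  have hX : ∀ᶠ y in 𝓝[s] z, localGrad G s (fun y ↦ f y ^ (p / 2)) y =
      (p * f y ^ ((p - 2) / 2)) • localCovDeriv Γ s g y (g y) := by
    filter_upwards [hev] with y ⟨h1, h2, h3⟩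
    subst hf hg hΓ
    rw [h1.localGrad_normSq_rpow hc hne hs h2 h3]
    congr 2
    · ring
    · congr 1; ring
  have hL' : ∀ᶠ y in 𝓝[s] z, L y = f y ^ ((p - 2) / 2) * (traceL E (localCovDeriv Γ s g y) +
      (p - 2) * (G y (localCovDeriv Γ s g y (g y)) (g y) / f y)) := by
    filter_upwards [hev] with y ⟨h1, h2, h3⟩
    subst hL hf hg hΓ
    refine (h1.trace_localCovDeriv_normSq_rpow_smul hc hne hs h2 h3 ((p - 2) / 2)).2.trans ?_
    beta_reduce
    ring
  have hL'z := hL'.self_of_nhdsWithin h.mem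
  have hmain := local_pBochner hc hne hs h.mem (G := G) (Γ := Γ) (g := g)
    (g' := fderivWithin ℝ g s) (p := p) hp h.differentiable.hasFDerivWithinAt h.symm_self
    (by rw [hΓ]; exact fderivWithin_metric (hs z h.mem) h.differentiable h.mem h.inv_self h.symm)
    (by rw [hΓ]; exact (differentiableWithinAt_christoffelL hs h.mem h.contDiff
          h.inv_self).hasFDerivWithinAt)
    (by rw [hΓ]; exact christoffelL_symm (hs z h.mem) h.differentiable h.mem h.symm)
    (hev.mono fun y hy ↦ by
      rw [hg]; exact (hy.1.differentiableWithinAt_localGrad hs hy.2.1).hasFDerivWithinAt)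
    (by rw [hg]
        exact (h.differentiableWithinAt_fderivWithin_localGrad hs hu hu3).hasFDerivWithinAt)
    (B := localCovDeriv Γ s g) (fun y ↦ rfl)
    (by rw [hΓ, hg]; exact h.localCovDeriv_localGrad_symm hc hne hs hu)
    (f := f) (fun y ↦ by rw [hf]) hpos (fun y ↦ rfl) (fun y ↦ rfl)
  obtain ⟨hd, hmain⟩ := hmain
  refine ⟨hd.congr_of_eventuallyEq hL' hL'z, ?_⟩
  rw [localCovDeriv_congr h.mem hX, Filter.EventuallyEq.fderivWithin_eq hL' hL'z, hL'z]
  rwa [← hΓ] at hmain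

end LocalBochner

section ChartDerivative

variable {E : Type*} [NormedAddCommGroup E] [NormedSpace ℝ E]
  {H : Type*} [TopologicalSpace H] (I : ModelWithCorners ℝ E H)
  {M : Type*} [TopologicalSpace M] [ChartedSpace H M]

/-- The derivative of the inverse of the chart at `x`, with the tangent spaces identified with
the model space. -/
def chartInvDeriv (x : M) (z : E) : E →L[ℝ] E :=
  mfderivWithin 𝓘(ℝ, E) I (extChartAt I x).symm (range I) z

/-- A vector field as a map into the model space. -/
def modelField (X : ∀ y : M, TangentSpace I y) (y : M) : E := X y

/-- The representative of a vector field in the chart at `x`. -/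
def chartField (X : ∀ y : M, TangentSpace I y) (x : M) (z : E) : E :=
  (chartInvDeriv I x z).inverse (modelField I X ((extChartAt I x).symm z))

theorem chartField_smul (h : M → ℝ) (X : ∀ y : M, TangentSpace I y) (x : M) (z : E) :
    chartField I (fun y ↦ h y • X y) x z =
      h ((extChartAt I x).symm z) • chartField I X x z :=
  map_smul (chartInvDeriv I x z).inverse _ _

variable [IsManifold I ∞ M]

theorem isInvertible_chartInvDeriv {x : M} {z : E} (hz : z ∈ (extChartAt I x).target) :
    (chartInvDeriv I x z).IsInvertible :=
  have : IsManifold I 1 M := .of_le (n := ∞) (by simp)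
  isInvertible_mfderivWithin_extChartAt_symm hz

theorem chartInvDeriv_self (x : M) :
    chartInvDeriv I x (extChartAt I x x) = ContinuousLinearMap.id ℝ E :=
  have : IsManifold I 1 M := .of_le (n := ∞) (by simp)
  mfderivWithin_range_extChartAt_symm

theorem chartField_self (X : ∀ y : M, TangentSpace I y) (x : M) :
    chartField I X x (extChartAt I x x) = X x := by
  rw [chartField, chartInvDeriv_self, ContinuousLinearMap.inverse_id, extChartAt_to_inv]
  rfl

theorem chartInvDeriv_chartField (X : ∀ y : M, TangentSpace I y) {x : M} {z : E}
    (hz : z ∈ (extChartAt I x).target) :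
    chartInvDeriv I x z (chartField I X x z) = modelField I X ((extChartAt I x).symm z) :=
  (isInvertible_chartInvDeriv I hz).self_apply_inverse _

/-- The chain rule for the inverse of a chart and a change of coordinates. -/
theorem chartInvDeriv_comp {x y : M} {z : E} (hz : z ∈ (extChartAt I y).target)
    (hzx : (extChartAt I y).symm z ∈ (extChartAt I x).source) :
    chartInvDeriv I x (extChartAt I x ((extChartAt I y).symm z)) ∘L
      fderivWithin ℝ (extChartAt I x ∘ (extChartAt I y).symm) (range I) z =
    chartInvDeriv I y z := by
  have : IsManifold I 1 M := .of_le (n := ∞) (by simp)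
  have hzr : z ∈ range I := extChartAt_target_subset_range y hz
  have h1 : fderivWithin ℝ (extChartAt I x ∘ (extChartAt I y).symm) (range I) z =
      mfderiv I 𝓘(ℝ, E) (extChartAt I x) ((extChartAt I y).symm z) ∘L
        mfderivWithin 𝓘(ℝ, E) I (extChartAt I y).symm (range I) z := by
    rw [← mfderivWithin_eq_fderivWithin, mfderiv_comp_mfderivWithin (I' := I)]
    · exact mdifferentiableAt_extChartAt (by rwa [← extChartAt_source I])
    · exact mdifferentiableWithinAt_extChartAt_symm hz
    · exact I.uniqueMDiffOn _ hzr
  have h2 := mfderivWithin_extChartAt_symm_comp_mfderiv_extChartAt' (I := I) hzx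
  ext v
  rw [h1]
  exact DFunLike.congr_fun h2 (chartInvDeriv I y z v)

theorem fderivWithin_comp_extChartAt_symm {u : M → ℝ} {x : M} {z : E}
    (hz : z ∈ (extChartAt I x).target)
    (hu : MDifferentiableAt I 𝓘(ℝ, ℝ) u ((extChartAt I x).symm z)) (w : E) :
    fderivWithin ℝ (u ∘ (extChartAt I x).symm) (range I) z w =
      mfderiv I 𝓘(ℝ, ℝ) u ((extChartAt I x).symm z) (chartInvDeriv I x z w) := by
  have : IsManifold I 1 M := .of_le (n := ∞) (by simp)
  rw [← mfderivWithin_eq_fderivWithin, mfderiv_comp_mfderivWithin (I' := I) _ hu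
    (mdifferentiableWithinAt_extChartAt_symm hz)
    (I.uniqueMDiffOn _ (extChartAt_target_subset_range x hz))]
  rfl

end ChartDerivative

section ChartMetric

variable {E : Type*} [NormedAddCommGroup E] [NormedSpace ℝ E]
  {H : Type*} [TopologicalSpace H] (I : ModelWithCorners ℝ E H)
  {M : Type*} [TopologicalSpace M] [ChartedSpace H M]
  [RiemannianBundle (fun x : M ↦ TangentSpace I x)]

/-- The scalar product of the tangent space at `y`, on the model space. -/
def modelInner (y : M) (v w : E) : ℝ := @inner ℝ (TangentSpace I y) _ v w

theorem modelInner_comm (y : M) (v w : E) : modelInner I y v w = modelInner I y w v :=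
  real_inner_comm (F := TangentSpace I y) w v

theorem modelInner_self_eq_zero {y : M} {v : E} : modelInner I y v v = 0 ↔ v = 0 :=
  inner_self_eq_zero (𝕜 := ℝ) (E := TangentSpace I y)

theorem chartMetric_apply (x : M) (z v w : E) : chartMetric I x z v w =
    modelInner I ((extChartAt I x).symm z) (chartInvDeriv I x z v) (chartInvDeriv I x z w) := rfl

theorem chartMetric_symm (x : M) (z v w : E) : chartMetric I x z v w = chartMetric I x z w v :=
  modelInner_comm I _ _ _

theorem covDeriv_eq_localCovDeriv (X : ∀ y : M, TangentSpace I y) (x : M) (v : E) :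
    covDeriv I X x v = localCovDeriv (christoffelL (chartMetric I x) (range I)) (range I)
      (chartField I X x) (extChartAt I x x) v := by
  simp only [localCovDeriv, add_apply, ContinuousLinearMap.flip_apply, christoffelL_apply]
  rfl

variable [IsManifold I ∞ M]

theorem chartMetric_chartField (X Y : ∀ y : M, TangentSpace I y) {x : M} {z : E}
    (hz : z ∈ (extChartAt I x).target) :
    chartMetric I x z (chartField I X x z) (chartField I Y x z) =
      inner ℝ (X ((extChartAt I x).symm z)) (Y ((extChartAt I x).symm z)) := by
  rw [chartMetric_apply, chartInvDeriv_chartField I X hz, chartInvDeriv_chartField I Y hz]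
  rfl

theorem chartMetric_self (x : M) (v w : E) :
    chartMetric I x (extChartAt I x x) v w = modelInner I x v w := by
  rw [chartMetric_apply, chartInvDeriv_self, extChartAt_to_inv]
  rfl

theorem isInvertible_chartMetric [FiniteDimensional ℝ E] {x : M} {z : E}
    (hz : z ∈ (extChartAt I x).target) : (chartMetric I x z).IsInvertible := by
  have hinj : Function.Injective ((chartMetric I x z : E →L[ℝ] E →L[ℝ] ℝ) : E →ₗ[ℝ] E →L[ℝ] ℝ) := by
    rw [← LinearMap.ker_eq_bot, LinearMap.ker_eq_bot']
    intro v hv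
    have h1 : chartMetric I x z v v = 0 := by
      have := DFunLike.congr_fun hv v
      exact this
    have h2 : chartInvDeriv I x z v = 0 := by
      rw [chartMetric_apply] at h1
      exact (modelInner_self_eq_zero I).1 h1
    exact (isInvertible_chartInvDeriv I hz).injective (by rw [h2, map_zero])
  have hdim : Module.finrank ℝ E = Module.finrank ℝ (E →L[ℝ] ℝ) := by
    rw [← (LinearMap.toContinuousLinearMap (𝕜 := ℝ) (E := E) (F' := ℝ)).finrank_eq]
    exact (Subspace.dual_finrank_eq).symm
  refine ⟨(LinearEquiv.ofInjectiveOfFinrankEq _ hinj hdim).toContinuousLinearEquiv, ?_⟩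
  ext v w
  rfl

theorem contDiffOn_chartMetric [FiniteDimensional ℝ E]
    [IsContMDiffRiemannianBundle I ∞ E (fun x : M ↦ TangentSpace I x)] (x : M) :
    ContDiffOn ℝ 2 (chartMetric I x) (extChartAt I x).target := by
  have : IsManifold I 1 M := .of_le (n := ∞) (by simp)
  set t := (extChartAt I x).target
  have hun : UniqueMDiffOn 𝓘(ℝ, E) t := by
    rw [uniqueMDiffOn_iff_uniqueDiffOn]; exact uniqueDiffOn_extChartAt_target x
  have htan := (contMDiffOn_extChartAt_symm (I := I) (n := ∞) x).contMDiffOn_tangentMapWithin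
    (m := 2) (by norm_cast) hun
  have hfield : ∀ v : E, ContMDiffOn 𝓘(ℝ, E) I.tangent 2
      (fun z ↦ (⟨(extChartAt I x).symm z, chartInvDeriv I x z v⟩ : TangentBundle I M)) t := by
    intro v
    have hc : ContMDiffOn 𝓘(ℝ, E) 𝓘(ℝ, E).tangent 2
        (fun z ↦ (⟨z, v⟩ : TangentBundle 𝓘(ℝ, E) E)) t := by
      exact contMDiffOn_vectorSpace_iff_contDiffOn.2 contDiffOn_const
    refine (htan.comp hc (fun z hz ↦ hz)).congr fun z hz ↦ ?_
    have : mfderivWithin 𝓘(ℝ, E) I (extChartAt I x).symm t z = chartInvDeriv I x z :=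
      (mdifferentiableWithinAt_extChartAt_symm hz).mfderivWithin_mono (hun z hz)
        (extChartAt_target_subset_range x)
    exact congrArg (fun A : E →L[ℝ] E ↦
      (⟨(extChartAt I x).symm z, A v⟩ : TangentBundle I M)) this.symm
  rw [contDiffOn_clm_apply]
  intro v
  rw [contDiffOn_clm_apply]
  intro w
  have := ContMDiffOn.inner_bundle (E := fun y : M ↦ TangentSpace I y) (IB := I) (n := 2) (F := E)
    (b := (extChartAt I x).symm)
    (v := fun z ↦ mfderivWithin 𝓘(ℝ, E) I (extChartAt I x).symm (range I) z v)
    (w := fun z ↦ mfderivWithin 𝓘(ℝ, E) I (extChartAt I x).symm (range I) z w)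
    (hfield v) (hfield w)
  exact contMDiffOn_iff_contDiffOn.1 this

theorem isMetricAt_chartMetric [FiniteDimensional ℝ E]
    [IsContMDiffRiemannianBundle I ∞ E (fun x : M ↦ TangentSpace I x)] {x : M} {z : E}
    (hz : z ∈ (extChartAt I x).target) : IsMetricAt (chartMetric I x) (range I) z where
  mem := extChartAt_target_subset_range x hz
  contDiff := (contDiffOn_chartMetric I x z hz).mono_of_mem_nhdsWithin
    (extChartAt_target_mem_nhdsWithin_of_mem hz)
  symm := Eventually.of_forall fun y ↦ chartMetric_symm I x y
  inv := by
    filter_upwards [extChartAt_target_mem_nhdsWithin_of_mem hz] with y hy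
      using isInvertible_chartMetric I hy

end ChartMetric

section Trace

variable {E : Type*} [NormedAddCommGroup E] [NormedSpace ℝ E] [FiniteDimensional ℝ E]
  {H : Type*} [TopologicalSpace H] (I : ModelWithCorners ℝ E H)
  {M : Type*} [TopologicalSpace M] [ChartedSpace H M]
  [RiemannianBundle (fun x : M ↦ TangentSpace I x)]

/-- The standard orthonormal basis of the tangent space at `x`, as vectors of the model space. -/
def modelBasis (x : M) (i : Fin (Module.finrank ℝ (TangentSpace I x))) : E :=
  stdOrthonormalBasis ℝ (TangentSpace I x) i

theorem sum_modelInner_modelBasis (x : M) (A : E →L[ℝ] E) :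
    ∑ i, modelInner I x (A (modelBasis I x i)) (modelBasis I x i) = traceL E A := by
  let A' : TangentSpace I x →ₗ[ℝ] TangentSpace I x := (A : E →ₗ[ℝ] E)
  have := LinearMap.trace_eq_sum_inner A' (stdOrthonormalBasis ℝ (TangentSpace I x))
  refine Eq.trans ?_ this.symm
  refine Finset.sum_congr rfl fun i _ ↦ ?_
  exact modelInner_comm I x _ _

theorem sum_modelInner_modelBasis_sq (x : M) (A : E →L[ℝ] E)
    (hA : ∀ v w, modelInner I x (A v) w = modelInner I x (A w) v) :
    ∑ i, ∑ j, modelInner I x (A (modelBasis I x i)) (modelBasis I x j) ^ 2 =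
      traceL E (A ∘L A) := by
  rw [← sum_modelInner_modelBasis I x]
  refine Finset.sum_congr rfl fun i _ ↦ ?_
  rw [ContinuousLinearMap.comp_apply, hA]
  exact ((stdOrthonormalBasis ℝ (TangentSpace I x)).sum_sq_inner_left (A (modelBasis I x i))).trans
    (real_inner_self_eq_norm_sq (F := TangentSpace I x) _).symm

theorem inner_grad (u : M → ℝ) (x : M) (w : TangentSpace I x) :
    inner ℝ (grad I u x) w = mfderiv I 𝓘(ℝ, ℝ) u x w := by
  have : CompleteSpace (TangentSpace I x) := FiniteDimensional.complete ℝ _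
  exact InnerProductSpace.toDual_symm_apply

theorem divergence_eq_traceL (X : ∀ y : M, TangentSpace I y) (x : M) :
    divergence I X x = traceL E (localCovDeriv (christoffelL (chartMetric I x) (range I)) (range I)
      (chartField I X x) (extChartAt I x x)) := by
  rw [← sum_modelInner_modelBasis I x]
  simp only [← covDeriv_eq_localCovDeriv]
  rfl

end Trace

section ChartChange

variable {E : Type*} [NormedAddCommGroup E] [NormedSpace ℝ E]
  {H : Type*} [TopologicalSpace H] (I : ModelWithCorners ℝ E H)
  {M : Type*} [TopologicalSpace M] [ChartedSpace H M]

theorem eventually_coordChange_source {x y : M} (hy : y ∈ (extChartAt I x).source) :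
    ∀ᶠ z in 𝓝[range I] (extChartAt I y y), z ∈ (extChartAt I y).target ∧
      (extChartAt I y).symm z ∈ (extChartAt I x).source := by
  refine Filter.Eventually.and (extChartAt_target_mem_nhdsWithin y) ?_
  have := (continuousAt_extChartAt_symm (I := I) y).continuousWithinAt (s := range I)
  refine this.eventually ?_
  rw [extChartAt_to_inv]
  exact extChartAt_source_mem_nhds' hy

variable [IsManifold I ∞ M]

theorem mdifferentiableAt_of_comp_extChartAt_symm {h : M → ℝ} {x y : M}
    (hy : y ∈ (extChartAt I x).source)
    (hd : DifferentiableWithinAt ℝ (h ∘ (extChartAt I x).symm) (range I) (extChartAt I x y)) :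
    MDifferentiableAt I 𝓘(ℝ, ℝ) h y := by
  have : IsManifold I 1 M := .of_le (n := ∞) (by simp)
  have h1 : MDifferentiableAt I 𝓘(ℝ, ℝ) ((h ∘ (extChartAt I x).symm) ∘ extChartAt I x) y := by
    rw [← mdifferentiableWithinAt_univ]
    refine MDifferentiableWithinAt.comp (I' := 𝓘(ℝ, E)) (u := range I) y
      hd.mdifferentiableWithinAt
      (mdifferentiableAt_extChartAt (by rwa [← extChartAt_source I])).mdifferentiableWithinAt ?_
    intro a _
    exact mem_range_self _
  refine h1.congr_of_eventuallyEq ?_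
  filter_upwards [extChartAt_source_mem_nhds' hy] with a ha
  rw [Function.comp_apply, Function.comp_apply, (extChartAt I x).left_inv ha]

theorem isInvertible_fderivWithin_coordChange {x y : M} {z : E}
    (hz : z ∈ (extChartAt I y).target)
    (hzx : (extChartAt I y).symm z ∈ (extChartAt I x).source) :
    (fderivWithin ℝ (extChartAt I x ∘ (extChartAt I y).symm) (range I) z).IsInvertible := by
  have hT := isInvertible_chartInvDeriv I ((extChartAt I x).map_source hzx)
  have h := hT.inverse.comp (isInvertible_chartInvDeriv I hz)
  rwa [← chartInvDeriv_comp I hz hzx, ← ContinuousLinearMap.comp_assoc, hT.inverse_comp_self,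
    ContinuousLinearMap.id_comp] at h

theorem fderivWithin_coordChange_chartField (X : ∀ y : M, TangentSpace I y) {x y : M} {z : E}
    (hz : z ∈ (extChartAt I y).target)
    (hzx : (extChartAt I y).symm z ∈ (extChartAt I x).source) :
    fderivWithin ℝ (extChartAt I x ∘ (extChartAt I y).symm) (range I) z (chartField I X y z) =
      chartField I X x ((extChartAt I x ∘ (extChartAt I y).symm) z) := by
  have hzt := (extChartAt I x).map_source hzx
  apply (isInvertible_chartInvDeriv I hzt).injective
  rw [Function.comp_apply, chartInvDeriv_chartField I X hzt, (extChartAt I x).left_inv hzx,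
    ← chartInvDeriv_chartField I X hz, ← chartInvDeriv_comp I hz hzx]
  rfl

variable [RiemannianBundle (fun x : M ↦ TangentSpace I x)]

theorem chartMetric_coordChange {x y : M} {z : E}
    (hz : z ∈ (extChartAt I y).target)
    (hzx : (extChartAt I y).symm z ∈ (extChartAt I x).source) (v w : E) :
    chartMetric I y z v w = chartMetric I x ((extChartAt I x ∘ (extChartAt I y).symm) z)
      (fderivWithin ℝ (extChartAt I x ∘ (extChartAt I y).symm) (range I) z v)
      (fderivWithin ℝ (extChartAt I x ∘ (extChartAt I y).symm) (range I) z w) := by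
  rw [chartMetric_apply, chartMetric_apply, ← chartInvDeriv_comp I hz hzx, Function.comp_apply,
    (extChartAt I x).left_inv hzx]
  rfl

variable [FiniteDimensional ℝ E]
  [IsContMDiffRiemannianBundle I ∞ E (fun x : M ↦ TangentSpace I x)]

/-- The divergence can be computed in any chart. -/
theorem divergence_eq_traceL_of_mem_source (X : ∀ y : M, TangentSpace I y) {x y : M}
    (hy : y ∈ (extChartAt I x).source)
    (hX : DifferentiableWithinAt ℝ (chartField I X x) (range I) (extChartAt I x y)) :
    divergence I X y = traceL E (localCovDeriv (christoffelL (chartMetric I x) (range I)) (range I)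
      (chartField I X x) (extChartAt I x y)) := by
  have hyy : (extChartAt I x ∘ (extChartAt I y).symm) (extChartAt I y y) = extChartAt I x y := by
    rw [Function.comp_apply, extChartAt_to_inv]
  have hmem : extChartAt I y y ∈ ((extChartAt I y).symm ≫ extChartAt I x).source := by
    simpa [PartialEquiv.trans_source] using hy
  have hev := eventually_coordChange_source I hy
  have hG := isMetricAt_chartMetric I ((extChartAt I x).map_source hy)
  have hcomp := localCovDeriv_comp (z := extChartAt I y y) (G := chartMetric I x)
    (G₂ := chartMetric I y)
    (Y := chartField I X x) (Y₂ := chartField I X y)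
    (ψ := extChartAt I x ∘ (extChartAt I y).symm) I.convex_range I.nonempty_interior
    I.uniqueDiffOn (mem_range_self _) ((contDiffWithinAt_ext_coord_change (n := ∞) x y hmem).of_le
      (by norm_cast))
    (Eventually.of_forall fun z ↦ mem_range_self _)
    (hev.mono fun z hz ↦ isInvertible_fderivWithin_coordChange I hz.1 hz.2)
    (by rw [hyy]; exact hG.differentiable) (by rw [hyy]; exact hG.inv_self)
    (isInvertible_chartMetric I (mem_extChartAt_target y)) (by rw [hyy]; exact hG.symm)
    (hev.mono fun z hz ↦ chartMetric_coordChange I hz.1 hz.2)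
    (by rw [hyy]; exact hX)
    (hev.mono fun z hz ↦ fderivWithin_coordChange_chartField I X hz.1 hz.2)
  obtain ⟨e, he⟩ := isInvertible_fderivWithin_coordChange I (x := x) (mem_extChartAt_target y)
    (by rwa [extChartAt_to_inv])
  rw [hyy, ← he] at hcomp
  rw [divergence_eq_traceL]
  set L₁ := localCovDeriv (christoffelL (chartMetric I x) (range I)) (range I)
    (chartField I X x) (extChartAt I x y)
  set L₂ := localCovDeriv (christoffelL (chartMetric I y) (range I)) (range I)
    (chartField I X y) (extChartAt I y y)
  have h1 : L₂ = (e.symm : E →L[ℝ] E) ∘L (L₁ ∘L (e : E →L[ℝ] E)) := by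
    ext v
    exact (e.symm_apply_eq.2 (hcomp v).symm).symm
  rw [h1, traceL_comp_comm, ContinuousLinearMap.comp_assoc]
  simp

theorem chartField_grad {u : M → ℝ} {x : M} {z : E} (hz : z ∈ (extChartAt I x).target)
    (hu : MDifferentiableAt I 𝓘(ℝ, ℝ) u ((extChartAt I x).symm z)) :
    chartField I (grad I u) x z =
      localGrad (chartMetric I x) (range I) (u ∘ (extChartAt I x).symm) z := by
  apply (isInvertible_chartMetric I hz).injective
  ext w
  rw [(isMetricAt_chartMetric I hz).localGrad_apply, chartMetric_apply,
    chartInvDeriv_chartField I _ hz, fderivWithin_comp_extChartAt_symm I hz hu]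
  exact inner_grad I u _ _

end ChartChange

section Bochner

variable {E : Type*} [NormedAddCommGroup E] [NormedSpace ℝ E] [FiniteDimensional ℝ E]
  {H : Type*} [TopologicalSpace H] (I : ModelWithCorners ℝ E H)
  {M : Type*} [TopologicalSpace M] [ChartedSpace H M]
  [RiemannianBundle (fun x : M ↦ TangentSpace I x)]

theorem ricci_eq_traceL {x : M} (v w : E)
    (hΓ : DifferentiableWithinAt ℝ (christoffelL (chartMetric I x) (range I)) (range I)
      (extChartAt I x x)) :
    ricci I x v w = traceL E (localCurvature
      (christoffelL (chartMetric I x) (range I) (extChartAt I x x))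
      (fderivWithin ℝ (christoffelL (chartMetric I x) (range I)) (range I) (extChartAt I x x))
      v w) := by
  have hu : UniqueDiffWithinAt ℝ (range I) (extChartAt I x x) :=
    I.uniqueDiffOn _ (mem_range_self _)
  have hd : ∀ a b c : E, fderivWithin ℝ (fun z ↦ christoffel (chartMetric I x) (range I) z b c)
      (range I) (extChartAt I x x) a = fderivWithin ℝ (christoffelL (chartMetric I x) (range I))
        (range I) (extChartAt I x x) a b c := by
    intro a b c
    simp only [← christoffelL_apply]
    rw [((hΓ.hasFDerivWithinAt.clm_apply (hasFDerivWithinAt_const b _ _)).clm_apply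
      (hasFDerivWithinAt_const c _ _)).fderivWithin hu]
    simp
  have hR : ∀ a : E, localCurvature (christoffelL (chartMetric I x) (range I) (extChartAt I x x))
      (fderivWithin ℝ (christoffelL (chartMetric I x) (range I)) (range I) (extChartAt I x x))
      v w a = curvature (chartMetric I x) (range I) (extChartAt I x x) a v w := by
    intro a
    rw [localCurvature_apply, curvature, hd, hd]
    simp only [christoffelL_apply]
  rw [← sum_modelInner_modelBasis I x]
  simp only [hR]
  rfl

variable [IsManifold I ∞ M]

theorem hessian_eq_chartMetric (u : M → ℝ) (x : M) (v w : E) :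
    hessian I u x v w = chartMetric I x (extChartAt I x x)
      (localCovDeriv (christoffelL (chartMetric I x) (range I)) (range I)
        (chartField I (grad I u) x) (extChartAt I x x) v) w := by
  rw [chartMetric_self, ← covDeriv_eq_localCovDeriv]
  rfl

theorem hessianNormSq_eq_traceL (u : M → ℝ) (x : M) {B : E →L[ℝ] E}
    (hB : B = localCovDeriv (christoffelL (chartMetric I x) (range I)) (range I)
      (chartField I (grad I u) x) (extChartAt I x x))
    (hsymm : ∀ v w, chartMetric I x (extChartAt I x x) (B v) w =
      chartMetric I x (extChartAt I x x) (B w) v) :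
    hessianNormSq I u x = traceL E (B ∘L B) := by
  rw [← sum_modelInner_modelBasis_sq I x B
    (fun v w ↦ by rw [← chartMetric_self, hsymm, chartMetric_self]), hB]
  simp only [← covDeriv_eq_localCovDeriv]
  rfl

theorem norm_grad_rpow {u : M → ℝ} {x : M} {z : E} (hz : z ∈ (extChartAt I x).target) (r : ℝ) :
    ‖grad I u ((extChartAt I x).symm z)‖ ^ r = (chartMetric I x z
      (chartField I (grad I u) x z) (chartField I (grad I u) x z)) ^ (r / 2) := by
  rw [chartMetric_chartField I _ _ hz, real_inner_self_eq_norm_sq, ← Real.rpow_natCast_mul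
    (norm_nonneg _)]
  congr 1
  push_cast
  ring

variable [IsContMDiffRiemannianBundle I ∞ E (fun x : M ↦ TangentSpace I x)]

theorem pBochnerIdentityAt {p : ℝ} (hp : p ≠ 0) {u : M → ℝ} {x : M}
    (hu : ContMDiffAt I 𝓘(ℝ, ℝ) 2 u x) (hgrad : grad I u x ≠ 0)
    (hu3 : ThriceDifferentiableAt I u x) : PBochnerIdentityAt I p u x := by
  have : IsManifold I 1 M := .of_le (n := ∞) (by simp)
  have : IsManifold I 2 M := .of_le (n := ∞) (by norm_cast)
  set s := range I
  set z := extChartAt I x x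
  set G := chartMetric I x
  set û : E → ℝ := u ∘ (extChartAt I x).symm with hûdef
  set g := localGrad G s û with hg
  set f : E → ℝ := fun y ↦ G y (g y) (g y) with hf
  set Γ := christoffelL G s with hΓ
  have hz : z ∈ (extChartAt I x).target := mem_extChartAt_target x
  have hzs : z ∈ s := mem_range_self _
  have hxz : (extChartAt I x).symm z = x := extChartAt_to_inv x
  have hm : IsMetricAt G s z := isMetricAt_chartMetric I hz
  have hû : ContDiffWithinAt ℝ 2 û s z := (contMDiffAt_iff.1 hu).2
  -- the chart representatives of the objects at hand, near `z`
  have hunhds : ∀ᶠ y in 𝓝 x, MDifferentiableAt I 𝓘(ℝ, ℝ) u y :=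
    ((contMDiffAt_iff_contMDiffAt_nhds (by simp)).1 hu).mono fun y hy ↦
      hy.mdifferentiableAt two_ne_zero
  have hev₀ : ∀ᶠ y in 𝓝[s] z, y ∈ (extChartAt I x).target ∧
      MDifferentiableAt I 𝓘(ℝ, ℝ) u ((extChartAt I x).symm y) := by
    refine Filter.Eventually.and (extChartAt_target_mem_nhdsWithin x) ?_
    refine ((continuousAt_extChartAt_symm (I := I) x).continuousWithinAt (s := s)).eventually ?_
    rwa [extChartAt_to_inv]
  have hgrad_chart : ∀ᶠ y in 𝓝[s] z, chartField I (grad I u) x y = g y :=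
    hev₀.mono fun y hy ↦ chartField_grad I hy.1 hy.2
  have hgz : g z = grad I u x := by
    rw [← hgrad_chart.self_of_nhdsWithin hzs]; exact chartField_self I _ x
  have hnorm : ∀ᶠ y in 𝓝[s] z, ∀ r : ℝ,
      ‖grad I u ((extChartAt I x).symm y)‖ ^ r = f y ^ (r / 2) := by
    filter_upwards [hev₀, hgrad_chart] with y hy hgy r
    rw [norm_grad_rpow I hy.1, hgy]
  have hnormz : ∀ r : ℝ, ‖grad I u x‖ ^ r = f z ^ (r / 2) := by
    have := hnorm.self_of_nhdsWithin hzs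
    rwa [hxz] at this
  have hfz : f z = ‖grad I u x‖ ^ 2 := by
    have := hnormz 2
    rw [div_self two_ne_zero, Real.rpow_one] at this
    rw [← this]; norm_cast
  have hpos : 0 < f z := by rw [hfz]; positivity
  have hfcont : ContinuousWithinAt f s z :=
    (hm.hasFDerivWithinAt_normSq_localGrad I.convex_range I.nonempty_interior I.uniqueDiffOn
      hû).continuousWithinAt
  have hev : ∀ᶠ y in 𝓝[s] z, y ∈ (extChartAt I x).target ∧ IsMetricAt G s y ∧
      ContDiffWithinAt ℝ 2 û s y ∧ 0 < f y := by
    filter_upwards [hev₀, hm.eventually, hû.eventually_nhdsWithin hzs,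
      hfcont.eventually (lt_mem_nhds hpos)] with y h1 h2 h3 h4 using ⟨h1.1, h2, h3, h4⟩
  -- the gradient of `|∇u|^p`
  have hη : ∀ᶠ y in 𝓝[s] z, chartField I (grad I fun y ↦ ‖grad I u y‖ ^ p) x y =
      localGrad G s (fun y ↦ f y ^ (p / 2)) y := by
    filter_upwards [hev, eventually_eventually_nhdsWithin.2 hnorm] with y ⟨hyt, hy, huy, hfy⟩ hny
    have hcongr : ((fun y ↦ ‖grad I u y‖ ^ p) ∘ (extChartAt I x).symm) =ᶠ[𝓝[s] y]
        fun y ↦ f y ^ (p / 2) := hny.mono fun a ha ↦ ha p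
    have hcongr' := hcongr.self_of_nhdsWithin hy.mem
    have hd := (hy.hasFDerivWithinAt_normSq_localGrad_rpow I.convex_range I.nonempty_interior
      I.uniqueDiffOn huy hfy (p / 2)).differentiableWithinAt.congr_of_eventuallyEq hcongr hcongr'
    rw [chartField_grad I hyt, localGrad, localGrad, hcongr.fderivWithin_eq hcongr']
    refine mdifferentiableAt_of_comp_extChartAt_symm I ((extChartAt I x).map_target hyt) ?_
    rwa [(extChartAt I x).right_inv hyt]
  -- the `p`-Laplacian
  set L : E → ℝ := fun y ↦ traceL E (localCovDeriv Γ s (fun y ↦ f y ^ ((p - 2) / 2) • g y) y)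
    with hL
  have hLap : ∀ᶠ y in 𝓝[s] z, (pLaplacian I p u ∘ (extChartAt I x).symm) y = L y := by
    filter_upwards [hev, eventually_eventually_nhdsWithin.2 hnorm,
      eventually_eventually_nhdsWithin.2 hgrad_chart] with y ⟨hyt, hy, huy, hfy⟩ hny hgy
    have hX : ∀ᶠ a in 𝓝[s] y, chartField I (fun y ↦ ‖grad I u y‖ ^ (p - 2) • grad I u y) x a =
        f a ^ ((p - 2) / 2) • g a := by
      filter_upwards [hny, hgy] with a h1 h2
      rw [chartField_smul, h1, h2]
    have hd := (hy.trace_localCovDeriv_normSq_rpow_smul I.convex_range I.nonempty_interior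
      I.uniqueDiffOn huy hfy ((p - 2) / 2)).1.congr_of_eventuallyEq hX
        (hX.self_of_nhdsWithin hy.mem)
    have hyy : extChartAt I x ((extChartAt I x).symm y) = y := (extChartAt I x).right_inv hyt
    rw [Function.comp_apply, pLaplacian, divergence_eq_traceL_of_mem_source I _
      ((extChartAt I x).map_target hyt) (by rwa [hyy]), hyy, localCovDeriv_congr hy.mem hX]
  have hLapz := hLap.self_of_nhdsWithin hzs
  set B := localCovDeriv Γ s g z with hB
  set C := localCovDeriv Γ s (localGrad G s fun y ↦ f y ^ (p / 2)) z with hC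
  obtain ⟨hLd, hmain⟩ := hm.pBochner I.convex_range I.nonempty_interior I.uniqueDiffOn hû hu3 hp
    hg hf hpos hΓ hB hC hL
  have hB' : localCovDeriv Γ s (chartField I (grad I u) x) z = B :=
    localCovDeriv_congr hzs hgrad_chart
  have hC' : localCovDeriv Γ s (chartField I (grad I fun y ↦ ‖grad I u y‖ ^ p) x) z = C :=
    localCovDeriv_congr hzs hη
  have hLdiff : MDifferentiableAt I 𝓘(ℝ, ℝ) (pLaplacian I p u) x :=
    mdifferentiableAt_of_comp_extChartAt_symm I (mem_extChartAt_source x)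
      (hLd.congr_of_eventuallyEq hLap hLapz)
  have e_lap : laplacian I (fun y ↦ ‖grad I u y‖ ^ p) x = traceL E C := by
    rw [laplacian, divergence_eq_traceL, ← hC']
  have e_hess : hessian I (fun y ↦ ‖grad I u y‖ ^ p) x (grad I u x) (grad I u x) =
      G z (C (g z)) (g z) := by
    rw [hgz, ← hC']; exact hessian_eq_chartMetric I _ x _ _
  have e_A : hessA I u x = G z (B (g z)) (g z) / f z := by
    rw [hessA, hfz, hgz, ← hB']
    exact congrArg (· / _) (hessian_eq_chartMetric I _ x _ _)
  have e_norm : hessianNormSq I u x = traceL E (B ∘L B) :=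
    hessianNormSq_eq_traceL I u x hB'.symm
      (hm.localCovDeriv_localGrad_symm I.convex_range I.nonempty_interior I.uniqueDiffOn hû)
  have e_ric : ricci I x (grad I u x) (grad I u x) =
      traceL E (localCurvature (Γ z) (fderivWithin ℝ Γ s z) (g z) (g z)) := by
    rw [hgz]
    exact ricci_eq_traceL I _ _
      (differentiableWithinAt_christoffelL I.uniqueDiffOn hzs hm.contDiff hm.inv_self)
  have e_pLap : pLaplacian I p u x = L z := by
    rw [← hLapz, Function.comp_apply, hxz]
  have e_grad : inner ℝ (grad I (pLaplacian I p u) x) (grad I u x) =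
      fderivWithin ℝ L s z (g z) := by
    rw [← Filter.EventuallyEq.fderivWithin_eq hLap hLapz,
      fderivWithin_comp_extChartAt_symm I hz (by rwa [hxz]), chartInvDeriv_self, inner_grad, hgz,
      hxz]
    rfl
  rw [PBochnerIdentityAt, linPLaplacianII, e_lap, e_hess, e_A, e_norm, e_ric, e_pLap, e_grad,
    hnormz, hnormz, hnormz, hnormz, mul_div_cancel_left₀ _ (two_ne_zero' ℝ)]
  exact hmain

end Bochner

end PBochner

end

open PBochner in
theorem mainTheorem8
    {E : Type*} [NormedAddCommGroup E] [NormedSpace ℝ E] [FiniteDimensional ℝ E]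
    {H : Type*} [TopologicalSpace H] (I : ModelWithCorners ℝ E H)
    {M : Type*} [TopologicalSpace M] [ChartedSpace H M] [IsManifold I ∞ M]
    [RiemannianBundle (fun x : M ↦ TangentSpace I x)]
    [IsContMDiffRiemannianBundle I ∞ E (fun x : M ↦ TangentSpace I x)]
    (p : ℝ) (hp : 1 < p) :
    (∀ (U : Set M) (u : M → ℝ), IsOpen U → ContMDiffOn I 𝓘(ℝ, ℝ) 2 u U →
      (∀ y ∈ U, grad I u y ≠ 0) →
      ∀ x ∈ U, ThriceDifferentiableAt I u x → PBochnerIdentityAt I p u x) ∧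
    (∀ (u : M → ℝ) (lam : ℝ) (x : M), ContMDiffAt I 𝓘(ℝ, ℝ) 2 u x →
      (∀ᶠ y in 𝓝 x, pLaplacian I p u y = -lam * (|u y| ^ (p - 2) * u y)) →
      grad I u x ≠ 0 → ThriceDifferentiableAt I u x → PBochnerIdentityAt I p u x) := by
  have hp0 : p ≠ 0 := (zero_lt_one.trans hp).ne'
  exact ⟨fun U u hU hu hgrad x hx hu3 ↦
      pBochnerIdentityAt I hp0 (hu.contMDiffAt (hU.mem_nhds hx)) (hgrad x hx) hu3,
    fun u _ x hu _ hgrad hu3 ↦ pBochnerIdentityAt I hp0 hu hgrad hu3⟩
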